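/- Let $\mathbb{D}$ be the open unit disc and let $H^2(\mathbb{D})$ be the Hardy space of analytic functions $f(z)=\sum_{n\ge 0}a_nz^n$ on $\mathbb{D}$ with $\|f\|^2=\sum_{n\ge 0}|a_n|^2<\infty$. For $\delta>0$ let $\phi^\delta(z)=\exp\left(-\delta\,\frac{1-z}{1+z}\right)$, $z\in\mathbb{D}$, and let $$K_{z\phi^\delta}=H^2(\mathbb{D})\ominus z\phi^\delta H^2(\mathbb{D})$$ be the model space associated with the inner function $z\phi^\delta(z)$, that is, the orthogonal complement of $z\phi^\delta H^2(\mathbb{D})$ in $H^2(\mathbb{D})$. Then, for every $\delta>0$, the subspace $$(1+z)K_{z\phi^\delta}=\{(1+z)f(z):\ f\in K_{z\phi^\delta}\}$$ is not closed in $H^2(\mathbb{D})$. -/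

import Mathlib

open Complex ComplexConjugate
open scoped UnitDisc ENNReal

noncomputable section

/-- Square-summable complex sequences `ℓ²(ℕ)`. -/
abbrev EllTwo : Type := lp (fun _ : ℕ => ℂ) 2

lemma EllTwo.summable_mul_pow (a : EllTwo) (z : 𝔻) :
    Summable (fun n : ℕ => a n * (z : ℂ) ^ n) := by
  have hz : ‖(z : ℂ)‖ < 1 := z.norm_lt_one
  refine Summable.of_norm_bounded
    (g := fun n => ‖a‖ * ‖(z : ℂ)‖ ^ n)
    ((summable_geometric_of_lt_one (norm_nonneg _) hz).mul_left _) fun n => ?_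
  rw [norm_mul, norm_pow]
  exact mul_le_mul_of_nonneg_right (lp.norm_apply_le_norm (by norm_num) a n) (by positivity)

/-- The function `z ↦ ∑ aₙ zⁿ` on the unit disc, for `a` in `ℓ²(ℕ)`. -/
def powerSeriesMap : EllTwo →ₗ[ℂ] (𝔻 → ℂ) where
  toFun a z := ∑' n : ℕ, a n * (z : ℂ) ^ n
  map_add' a b := by
    funext z
    simp only [lp.coeFn_add, Pi.add_apply, add_mul]
    exact (a.summable_mul_pow z).tsum_add (b.summable_mul_pow z)
  map_smul' c a := by
    funext z
    simp only [lp.coeFn_smul, Pi.smul_apply, smul_eq_mul, RingHom.id_apply, mul_assoc]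
    exact tsum_mul_left

lemma powerSeriesMap_injective : Function.Injective powerSeriesMap := by
  rw [← LinearMap.ker_eq_bot, LinearMap.ker_eq_bot']
  intro a ha
  have h1 : HasFPowerSeriesOnBall (fun _ : ℂ => (0 : ℂ))
      (FormalMultilinearSeries.ofScalars ℂ (fun n => a n)) 0 1 := by
    refine ⟨?_, by norm_num, ?_⟩
    · refine FormalMultilinearSeries.le_radius_of_bound _ ‖a‖ fun n => ?_
      simp only [FormalMultilinearSeries.ofScalars_norm, NNReal.coe_one, one_pow, mul_one]
      exact lp.norm_apply_le_norm (by norm_num) a n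
    · intro y hy
      have hy' : ‖y‖ < 1 := by
        simpa [Metric.mem_eball, edist_zero_right, enorm_eq_nnnorm, ← NNReal.coe_lt_coe] using hy
      have h2 := (a.summable_mul_pow (UnitDisc.mk y hy')).hasSum
      have h3 : ∑' n : ℕ, a n * ((UnitDisc.mk y hy' : 𝔻) : ℂ) ^ n = 0 :=
        congrFun ha (UnitDisc.mk y hy')
      rw [h3] at h2
      simpa [FormalMultilinearSeries.ofScalars_apply_eq, mul_comm] using h2
  have h4 := h1.hasFPowerSeriesAt.eq_zero
  ext n
  have h5 := congrArg (fun p : FormalMultilinearSeries ℂ ℂ ℂ => ‖p n‖) h4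
  simpa [FormalMultilinearSeries.ofScalars_norm] using h5

/-- The functions `f` on the unit disc of the form `f(z) = ∑ aₙ zⁿ` with `∑ |aₙ|² < ∞`. -/
def hardySubmodule : Submodule ℂ (𝔻 → ℂ) := LinearMap.range powerSeriesMap

/-- The Hardy space `H²(𝔻)`: the analytic functions on the unit disc whose Taylor coefficients
at the origin are square summable. It is a type of its own, so that its topology is the one given
by the Hardy norm and not the one of pointwise convergence. -/
def HardySpace : Type := hardySubmodule

namespace HardySpace

instance : AddCommGroup HardySpace := inferInstanceAs (AddCommGroup hardySubmodule)

instance : Module ℂ HardySpace := inferInstanceAs (Module ℂ hardySubmodule)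

/-- Elements of `H²(𝔻)` are functions on the unit disc. -/
instance : FunLike HardySpace 𝔻 ℂ where
  coe f := f.1
  coe_injective := Subtype.val_injective

@[simp] lemma zero_apply (z : 𝔻) : (0 : HardySpace) z = 0 := rfl

@[simp] lemma add_apply (f g : HardySpace) (z : 𝔻) : (f + g) z = f z + g z := rfl

@[simp] lemma smul_apply (c : ℂ) (f : HardySpace) (z : 𝔻) : (c • f) z = c * f z := rfl

/-- The sequence of Taylor coefficients of a function in `H²(𝔻)`. -/
def coeff : HardySpace ≃ₗ[ℂ] EllTwo :=
  (LinearEquiv.ofInjective powerSeriesMap powerSeriesMap_injective).symm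

lemma hasSum_coeff (f : HardySpace) (z : 𝔻) :
    HasSum (fun n : ℕ => coeff f n * (z : ℂ) ^ n) (f z) := by
  have h : powerSeriesMap (coeff f) z = f z :=
    congrFun (LinearEquiv.ofInjective_symm_apply (h := powerSeriesMap_injective)
      powerSeriesMap f) z
  rw [← h]
  exact (EllTwo.summable_mul_pow (coeff f) z).hasSum

/-- The Hardy norm, `‖f‖² = ∑ |aₙ|²`. -/
instance : NormedAddCommGroup HardySpace :=
  NormedAddCommGroup.induced HardySpace EllTwo coeff coeff.injective

/-- The inner product of `H²(𝔻)`, the `ℓ²` inner product of the Taylor coefficients. -/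
instance : InnerProductSpace ℂ HardySpace where
  toNormedSpace := NormedSpace.induced ℂ HardySpace EllTwo coeff
  inner f g := inner ℂ (coeff f) (coeff g)
  norm_sq_eq_re_inner f := norm_sq_eq_re_inner (𝕜 := ℂ) (coeff f)
  conj_inner_symm f g := inner_conj_symm (coeff f) (coeff g)
  add_left f g h := by rw [map_add, inner_add_left]
  smul_left f g c := by rw [map_smul, inner_smul_left]

lemma inner_eq_tsum (f g : HardySpace) :
    inner ℂ f g = ∑' n : ℕ, conj (coeff f n) * coeff g n := by
  change inner ℂ (coeff f) (coeff g) = _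
  rw [lp.inner_eq_tsum]
  simp [mul_comm]

/-- The subspace `g M` of `H²(𝔻)`: the functions in `H²(𝔻)` of the form `z ↦ g(z) m(z)` with
`m` in `M`. If `g` is bounded and analytic then `g m` is in `H²(𝔻)` for all `m` in `M`. -/
def mulSubspace (g : 𝔻 → ℂ) (M : Submodule ℂ HardySpace) : Submodule ℂ HardySpace where
  carrier := {f | ∃ m ∈ M, ∀ z : 𝔻, f z = g z * m z}
  zero_mem' := ⟨0, M.zero_mem, fun z => by simp⟩
  add_mem' := by
    rintro f₁ f₂ ⟨m₁, h₁, e₁⟩ ⟨m₂, h₂, e₂⟩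
    exact ⟨m₁ + m₂, M.add_mem h₁ h₂, fun z => by simp [e₁ z, e₂ z, mul_add]⟩
  smul_mem' := by
    rintro c f ⟨m, h, e⟩
    exact ⟨c • m, M.smul_mem c h, fun z => by simp [e z]; ring⟩

/-- The model space `K_u = H²(𝔻) ⊖ u H²(𝔻)`, for an inner function `u`. -/
def modelSpace (u : 𝔻 → ℂ) : Submodule ℂ HardySpace := (mulSubspace u ⊤)ᗮ

end HardySpace

/-- The power `φ^t(z) = exp(-t (1 - z) / (1 + z))` of the atomic inner function with atom `-1`. -/
def atomicInner (t : ℝ) (z : 𝔻) : ℂ := Complex.exp (-(t : ℂ) * ((1 - (z : ℂ)) / (1 + (z : ℂ))))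

end

open MeasureTheory Filter Topology

/-! Write `u = z φ^δ` and `K = K_u`. Since `1 + z` has no zero in the disc, a closed `(1 + z) K`
would, by the closed graph theorem, make multiplication by `1 + z` bounded below on `K`
(`exists_norm_le_of_isClosed_mulSubspace`). The reproducing kernels of `K` at `-r`, namely `f = (1 -
conj (u(-r)) u(z)) / (1 + r z)`, contradict this as `r → 1`. The atom of `φ^δ` sits at `-1`, so
`|u(-r)| ≤ e^{-δ}` and `‖f‖²` grows at least like `(1 - r²)⁻¹`, while `|1 + z| ≤ 2 |1 + r z|` keeps
`(1 + z) f` bounded by `4` (`exists_mem_modelSpace`). That `f` lies in `K` rests on multiplication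
by `u` preserving inner products (`inner_mul_eq_inner`). This is proved with integrals over circles
of radius `r < 1` and the radial limits of `|u|` alone; no boundary values of Hardy functions are
used. -/

/-! ### Parseval's identity on the circle. -/

lemma integral_exp_int_mul (k : ℤ) :
    ∫ θ in (-Real.pi)..Real.pi, exp (k * θ * I) = if k = 0 then 2 * Real.pi else 0 := by
  split_ifs with hk
  · subst hk
    simp
    ring
  · have hk' : (k : ℂ) * I ≠ 0 := mul_ne_zero (by exact_mod_cast hk) I_ne_zero
    have h1 : ∀ θ : ℝ, exp (k * θ * I) = exp ((k * I) * θ) := fun θ => by ring_nf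
    simp_rw [h1]
    have h2 : exp (k * I * Real.pi) = exp (k * I * (-Real.pi : ℝ)) := by
      rw [exp_eq_exp_iff_exists_int]
      exact ⟨k, by push_cast; ring⟩
    rw [integral_exp_mul_complex hk', h2, sub_self, zero_div, ofReal_zero]

lemma norm_exp_nat_mul (n : ℕ) (θ : ℝ) : ‖exp (n * θ * I)‖ = 1 := by
  have := norm_exp_ofReal_mul_I (n * θ)
  push_cast at this
  exact this

lemma continuous_tsum_exp {x : ℕ → ℂ} (hx : Summable fun n => ‖x n‖) :
    Continuous fun θ : ℝ => ∑' n, x n * exp (n * θ * I) := by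
  refine continuous_tsum (fun n => by fun_prop) hx fun n θ => ?_
  rw [norm_mul, norm_exp_nat_mul, mul_one]

/-- Parseval uses this twice: with `g` an exponential, to extract one coefficient, and with `g` the
conjugate of the other series. -/
lemma hasSum_integral_tsum_exp_mul {x : ℕ → ℂ} (hx : Summable fun n => ‖x n‖) {g : ℝ → ℂ}
    (hg : Continuous g) :
    HasSum (fun n => x n * ∫ θ in (-Real.pi)..Real.pi, exp (n * θ * I) * g θ)
      (∫ θ in (-Real.pi)..Real.pi, (∑' n, x n * exp (n * θ * I)) * g θ) := by
  obtain ⟨C, hC⟩ := isCompact_uIcc.exists_bound_of_continuousOn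
    (s := Set.uIcc (-Real.pi) Real.pi) hg.continuousOn
  simp_rw [← intervalIntegral.integral_const_mul]
  refine intervalIntegral.hasSum_integral_of_dominated_convergence
    (fun n _ => ‖x n‖ * C) (fun n => ?_) (fun n => ?_) ?_ ?_ ?_
  · exact Continuous.aestronglyMeasurable (by fun_prop)
  · refine .of_forall fun θ hθ => ?_
    rw [norm_mul, norm_mul, norm_exp_nat_mul, one_mul]
    exact mul_le_mul_of_nonneg_left (hC θ (Set.uIoc_subset_uIcc hθ)) (norm_nonneg _)
  · exact .of_forall fun θ _ => hx.mul_right C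
  · exact intervalIntegrable_const
  · refine .of_forall fun θ _ => ?_
    have : Summable fun n => x n * exp (n * θ * I) := by
      refine .of_norm ?_
      simpa only [norm_mul, norm_exp_nat_mul, mul_one] using hx
    simpa only [mul_assoc] using this.hasSum.mul_right (g θ)

/-- Parseval's identity for absolutely convergent trigonometric series. -/
lemma integral_conj_tsum_exp_mul_tsum_exp {x y : ℕ → ℂ} (hx : Summable fun n => ‖x n‖)
    (hy : Summable fun n => ‖y n‖) :
    ∫ θ in (-Real.pi)..Real.pi,
        conj (∑' n, x n * exp (n * θ * I)) * ∑' n, y n * exp (n * θ * I) =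
      2 * Real.pi * ∑' n, conj (x n) * y n := by
  have hcoeff : ∀ m : ℕ, ∫ θ in (-Real.pi)..Real.pi,
      (∑' n, x n * exp (n * θ * I)) * exp (-(m * θ * I)) = 2 * Real.pi * x m := by
    intro m
    have h := hasSum_integral_tsum_exp_mul hx (g := fun θ : ℝ => exp (-(m * θ * I)))
      (by fun_prop)
    have h2 : ∀ n : ℕ, x n * ∫ θ in (-Real.pi)..Real.pi, exp (n * θ * I) * exp (-(m * θ * I)) =
        if n = m then 2 * Real.pi * x m else 0 := by
      intro n
      have h3 : ∀ θ : ℝ, exp (n * θ * I) * exp (-(m * θ * I)) =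
          exp (((n - m : ℤ) : ℂ) * θ * I) := fun θ => by
        rw [← exp_add]; push_cast; ring_nf
      simp_rw [h3]
      rw [integral_exp_int_mul]
      by_cases hnm : n = m
      · subst hnm; simp [mul_comm]
      · have : (n : ℤ) - m ≠ 0 := by omega
        simp [hnm, this]
    simp_rw [h2] at h
    exact h.unique (hasSum_ite_eq m _)
  have h := hasSum_integral_tsum_exp_mul hy
    (g := fun θ : ℝ => conj (∑' n, x n * exp (n * θ * I)))
    (continuous_conj.comp (continuous_tsum_exp hx))
  have h2 : ∀ m : ℕ, ∫ θ in (-Real.pi)..Real.pi,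
      exp (m * θ * I) * conj (∑' n, x n * exp (n * θ * I)) = 2 * Real.pi * conj (x m) := by
    intro m
    have h3 := congrArg conj (hcoeff m)
    rw [← intervalIntegral.intervalIntegral_conj] at h3
    simpa [← exp_conj, mul_comm, map_ofNat] using h3
  simp_rw [h2] at h
  simp_rw [mul_comm (conj _) (tsum _)]
  rw [← h.tsum_eq, ← tsum_mul_left]
  exact tsum_congr fun n => by ring

/-! ### Hardy space: circle means, bounded functions, Szegő kernels, inner multipliers. -/

namespace HardySpace

/-- The sum of the Taylor series of `f` at a complex number. -/
noncomputable def series (f : HardySpace) (z : ℂ) : ℂ := ∑' n, coeff f n * z ^ n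

lemma series_coe (f : HardySpace) (z : 𝔻) : series f z = f z := (hasSum_coeff f z).tsum_eq

lemma norm_coeff_le (f : HardySpace) (n : ℕ) : ‖coeff f n‖ ≤ ‖f‖ :=
  lp.norm_apply_le_norm (by norm_num) (coeff f) n

lemma summable_norm_coeff_mul_pow (f : HardySpace) {r : ℝ} (hr0 : 0 ≤ r) (hr1 : r < 1) :
    Summable fun n => ‖coeff f n * (r : ℂ) ^ n‖ := by
  refine Summable.of_nonneg_of_le (fun n => norm_nonneg _) (fun n => ?_)
    ((summable_geometric_of_lt_one hr0 hr1).mul_left ‖f‖)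
  rw [norm_mul, norm_pow, norm_real, Real.norm_of_nonneg hr0]
  exact mul_le_mul_of_nonneg_right (norm_coeff_le f n) (by positivity)

lemma series_circle (f : HardySpace) (r θ : ℝ) :
    series f (r * exp (θ * I)) = ∑' n, (coeff f n * (r : ℂ) ^ n) * exp (n * θ * I) := by
  refine tsum_congr fun n => ?_
  rw [mul_pow, ← exp_nat_mul]
  ring_nf

lemma continuous_series_circle (f : HardySpace) {r : ℝ} (hr0 : 0 ≤ r) (hr1 : r < 1) :
    Continuous fun θ : ℝ => series f (r * exp (θ * I)) := by
  simp_rw [series_circle]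
  exact continuous_tsum_exp (summable_norm_coeff_mul_pow f hr0 hr1)

/-- The Hardy inner product is the limit of the `L²` inner products over circles. -/
lemma tendsto_integral_circle (f g : HardySpace) :
    Tendsto (fun r : ℝ => ∫ θ in (-Real.pi)..Real.pi,
      conj (series f (r * exp (θ * I))) * series g (r * exp (θ * I)))
      (𝓝[<] 1) (𝓝 (2 * Real.pi * inner ℂ f g)) := by
  have hev : ∀ᶠ r : ℝ in 𝓝[<] 1, 0 ≤ r ∧ r < 1 := by
    filter_upwards [Ioo_mem_nhdsLT (zero_lt_one' ℝ)] with r hr using ⟨hr.1.le, hr.2⟩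
  have h1 : Tendsto (fun r : ℝ => ∑' n, conj (coeff f n * (r : ℂ) ^ n) *
      (coeff g n * (r : ℂ) ^ n)) (𝓝[<] 1) (𝓝 (inner ℂ f g)) := by
    rw [inner_eq_tsum]
    refine tendsto_tsum_of_dominated_convergence
      (bound := fun n => ‖conj (coeff f n) * coeff g n‖) ?_ (fun n => ?_) ?_
    · simpa [mul_comm] using (lp.summable_inner (𝕜 := ℂ) (coeff f) (coeff g)).norm
    · have : Continuous fun r : ℝ => conj (coeff f n * (r : ℂ) ^ n) *
          (coeff g n * (r : ℂ) ^ n) := by fun_prop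
      simpa using (this.tendsto 1).mono_left nhdsWithin_le_nhds
    · filter_upwards [hev] with r hr n
      have hp : r ^ n ≤ 1 := pow_le_one₀ hr.1 hr.2.le
      have hp0 : 0 ≤ r ^ n := pow_nonneg hr.1 n
      simp only [norm_mul, RCLike.norm_conj, norm_pow, norm_real, Real.norm_of_nonneg hr.1]
      exact mul_le_mul (mul_le_of_le_one_right (norm_nonneg _) hp)
        (mul_le_of_le_one_right (norm_nonneg _) hp) (by positivity) (norm_nonneg _)
  refine (h1.const_mul (2 * (Real.pi : ℂ))).congr' ?_
  filter_upwards [hev] with r hr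
  simp_rw [series_circle]
  rw [integral_conj_tsum_exp_mul_tsum_exp (summable_norm_coeff_mul_pow f hr.1 hr.2)
    (summable_norm_coeff_mul_pow g hr.1 hr.2)]

lemma hasSum_norm_sq_coeff (f : HardySpace) : HasSum (fun n => ‖coeff f n‖ ^ 2) (‖f‖ ^ 2) := by
  have := lp.hasSum_norm (p := 2) (by norm_num) (coeff f)
  simp only [ENNReal.toReal_ofNat, Real.rpow_ofNat] at this
  exact this

/-- Bounded analytic functions belong to the Hardy space. -/
lemma exists_of_bounded {F : ℂ → ℂ} (hF : DifferentiableOn ℂ F (Metric.ball 0 1)) {C : ℝ}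
    (hC : ∀ z ∈ Metric.ball (0 : ℂ) 1, ‖F z‖ ≤ C) :
    ∃ f : HardySpace, (∀ z : 𝔻, f z = F z) ∧ ‖f‖ ≤ C := by
  have hC0 : 0 ≤ C := (norm_nonneg _).trans (hC 0 (by simp))
  set a : ℕ → ℂ := fun n => (n.factorial : ℂ)⁻¹ * iteratedDeriv n F 0 with ha
  have hsum : ∀ z ∈ Metric.ball (0 : ℂ) 1, HasSum (fun n => a n * z ^ n) (F z) := by
    intro z hz
    have := Complex.hasSum_taylorSeries_on_ball (r := 1) (by simpa using hF) hz
    simpa [ha, mul_comm, mul_left_comm, mul_assoc] using this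
  have hnorm : ∀ r : ℝ, 0 ≤ r → r < 1 → Summable fun n => ‖a n * (r : ℂ) ^ n‖ := by
    intro r hr0 hr1
    exact (hsum r (by simpa [abs_of_nonneg hr0] using hr1)).summable.norm
  have hcirc : ∀ r : ℝ, 0 ≤ r → r < 1 → ∀ θ : ℝ,
      ∑' n, (a n * (r : ℂ) ^ n) * exp (n * θ * I) = F (r * exp (θ * I)) := by
    intro r hr0 hr1 θ
    have hz : (r : ℂ) * exp (θ * I) ∈ Metric.ball (0 : ℂ) 1 := by
      simpa [norm_exp_ofReal_mul_I, abs_of_nonneg hr0] using hr1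
    rw [← (hsum _ hz).tsum_eq]
    refine tsum_congr fun n => ?_
    rw [mul_pow, ← exp_nat_mul]
    ring_nf
  -- Parseval on the circle of radius `r`, where `|F| ≤ C`. The bound does not depend on `r`, so `r
  -- → 1` is harmless in each finite sum.
  have hpars : ∀ r : ℝ, 0 ≤ r → r < 1 → ∀ s : Finset ℕ,
      ∑ n ∈ s, ‖a n * (r : ℂ) ^ n‖ ^ 2 ≤ C ^ 2 := by
    intro r hr0 hr1 s
    have h := integral_conj_tsum_exp_mul_tsum_exp (hnorm r hr0 hr1) (hnorm r hr0 hr1)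
    have hs2 : Summable fun n => ‖a n * (r : ℂ) ^ n‖ ^ 2 := by
      refine Summable.of_nonneg_of_le (fun n => by positivity) (fun n => ?_)
        ((hnorm r hr0 hr1).mul_right (∑' n, ‖a n * (r : ℂ) ^ n‖))
      rw [pow_two]
      exact mul_le_mul_of_nonneg_left
        ((hnorm r hr0 hr1).le_tsum n fun m _ => norm_nonneg _) (norm_nonneg _)
    have hle : ‖∫ θ in (-Real.pi)..Real.pi,
        conj (∑' n, (a n * (r : ℂ) ^ n) * exp (n * θ * I)) *
          ∑' n, (a n * (r : ℂ) ^ n) * exp (n * θ * I)‖ ≤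
        C ^ 2 * |Real.pi - -Real.pi| := by
      refine intervalIntegral.norm_integral_le_of_norm_le_const fun θ _ => ?_
      rw [hcirc r hr0 hr1, norm_mul, RCLike.norm_conj, ← pow_two]
      refine pow_le_pow_left₀ (norm_nonneg _) (hC _ ?_) 2
      simpa [norm_exp_ofReal_mul_I, abs_of_nonneg hr0] using hr1
    have hts : ∑' n, conj (a n * (r : ℂ) ^ n) * (a n * (r : ℂ) ^ n) =
        ((∑' n, ‖a n * (r : ℂ) ^ n‖ ^ 2 : ℝ) : ℂ) := by
      rw [ofReal_tsum]
      exact tsum_congr fun n => by rw [mul_comm, mul_conj, normSq_eq_norm_sq]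
    rw [h, hts, norm_mul, norm_real, Real.norm_of_nonneg (tsum_nonneg fun n => by positivity)]
      at hle
    have hpi := Real.pi_pos
    have h2 : ‖(2 * Real.pi : ℂ)‖ = 2 * Real.pi := by
      simp [abs_of_pos hpi]
    rw [h2, sub_neg_eq_add, ← two_mul, abs_of_pos (by positivity), mul_comm] at hle
    exact (hs2.sum_le_tsum s fun n _ => by positivity).trans
      (le_of_mul_le_mul_right hle (by positivity))
  have hfin : ∀ s : Finset ℕ, ∑ n ∈ s, ‖a n‖ ^ 2 ≤ C ^ 2 := by
    intro s
    have hcont : Continuous fun r : ℝ => ∑ n ∈ s, ‖a n * (r : ℂ) ^ n‖ ^ 2 := by fun_prop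
    have ht : Tendsto (fun r : ℝ => ∑ n ∈ s, ‖a n * (r : ℂ) ^ n‖ ^ 2) (𝓝[<] 1)
        (𝓝 (∑ n ∈ s, ‖a n‖ ^ 2)) := by
      simpa using (hcont.tendsto 1).mono_left nhdsWithin_le_nhds
    refine le_of_tendsto ht ?_
    filter_upwards [Ioo_mem_nhdsLT (zero_lt_one' ℝ)] with r hr using hpars r hr.1.le hr.2 s
  have hmem : Memℓp a 2 := by
    refine memℓp_gen' (C := C ^ 2) fun s => ?_
    simpa using hfin s
  refine ⟨coeff.symm ⟨a, hmem⟩, fun z => ?_, ?_⟩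
  · have h1 := hasSum_coeff (coeff.symm ⟨a, hmem⟩) z
    rw [LinearEquiv.apply_symm_apply] at h1
    exact h1.unique (hsum z (by simpa using z.norm_lt_one))
  · refine le_of_sq_le_sq ?_ hC0
    have h1 := hasSum_norm_sq_coeff (coeff.symm ⟨a, hmem⟩)
    rw [LinearEquiv.apply_symm_apply] at h1
    exact hasSum_le_of_sum_le h1 hfin

/-- The Szegő kernel at `w`. -/
lemma exists_kernel (w : 𝔻) : ∃ s : HardySpace,
    (∀ z : 𝔻, s z = (1 - conj (w : ℂ) * z)⁻¹) ∧ ∀ f : HardySpace, inner ℂ s f = f w := by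
  have hw := w.norm_lt_one
  have hmem : Memℓp (fun n => conj (w : ℂ) ^ n) 2 := by
    refine memℓp_gen ?_
    have : Summable fun n : ℕ => (‖(w : ℂ)‖ ^ 2) ^ n :=
      summable_geometric_of_lt_one (by positivity) (pow_lt_one₀ (norm_nonneg _) hw two_ne_zero)
    simpa [← pow_mul, mul_comm] using this
  have hc : ∀ n, coeff (coeff.symm ⟨_, hmem⟩) n = conj (w : ℂ) ^ n := fun n => by
    rw [LinearEquiv.apply_symm_apply]
  refine ⟨coeff.symm ⟨_, hmem⟩, fun z => ?_, fun f => ?_⟩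
  · have h1 := hasSum_coeff (coeff.symm ⟨_, hmem⟩) z
    simp_rw [hc, ← mul_pow] at h1
    refine h1.unique (hasSum_geometric_of_norm_lt_one ?_)
    rw [norm_mul, RCLike.norm_conj]
    exact mul_lt_one_of_nonneg_of_lt_one_left (norm_nonneg _) hw z.norm_lt_one.le
  · rw [inner_eq_tsum, ← (hasSum_coeff f w).tsum_eq]
    refine tsum_congr fun n => ?_
    rw [hc]
    simp [mul_comm]

instance : CompleteSpace HardySpace := by
  have hi : Isometry (coeff : HardySpace → EllTwo) := AddMonoidHomClass.isometry_of_norm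
    (coeff : HardySpace →ₗ[ℂ] EllTwo) fun f => rfl
  exact hi.isUniformInducing.completeSpace (by
    rw [coeff.surjective.range_eq]; exact isClosed_univ.isComplete)

/-- Evaluation is the inner product with a Szegő kernel. Hence norm limits are pointwise limits,
which the closed graph argument needs. -/
lemma continuous_eval (w : 𝔻) : Continuous fun f : HardySpace => f w := by
  obtain ⟨s, -, hs⟩ := exists_kernel w
  simp_rw [← hs]
  fun_prop

lemma tendsto_integral_norm_sq_circle (f : HardySpace) :
    Tendsto (fun r : ℝ => ∫ θ in (-Real.pi)..Real.pi, ‖series f (r * exp (θ * I))‖ ^ 2)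
      (𝓝[<] 1) (𝓝 (2 * Real.pi * ‖f‖ ^ 2)) := by
  have h := (continuous_re.tendsto _).comp (tendsto_integral_circle f f)
  rw [inner_self_eq_norm_sq_to_K] at h
  have h1 : (2 * Real.pi * ((‖f‖ : ℝ) : ℂ) ^ 2).re = 2 * Real.pi * ‖f‖ ^ 2 := by
    exact_mod_cast ofReal_re _
  refine (h.congr fun r => ?_).trans_eq (congrArg 𝓝 h1)
  have h2 : ∀ θ : ℝ, conj (series f (r * exp (θ * I))) * series f (r * exp (θ * I)) =
      ((‖series f (r * exp (θ * I))‖ ^ 2 : ℝ) : ℂ) := fun θ => by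
    rw [mul_comm, mul_conj, normSq_eq_norm_sq]
  simp only [Function.comp_apply, h2]
  rw [intervalIntegral.integral_ofReal, ofReal_re]

lemma norm_circle_lt_one {r : ℝ} (hr0 : 0 ≤ r) (hr1 : r < 1) (θ : ℝ) :
    ‖(r : ℂ) * exp (θ * I)‖ < 1 := by
  simpa [norm_exp_ofReal_mul_I, abs_of_nonneg hr0] using hr1

/-- Multiplication by a bounded function with unimodular radial limits preserves inner products. -/
lemma inner_mul_eq_inner {F : ℂ → ℂ} (hFc : ContinuousOn F (Metric.ball 0 1))
    (hF1 : ∀ z ∈ Metric.ball (0 : ℂ) 1, ‖F z‖ ≤ 1)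
    (hFr : ∀ᵐ θ : ℝ, θ ∈ Set.uIoc (-Real.pi) Real.pi →
      Tendsto (fun r : ℝ => ‖F (r * exp (θ * I))‖) (𝓝[<] 1) (𝓝 1))
    {h g s t : HardySpace} (hg : ∀ z : 𝔻, g z = F z * h z) (ht : ∀ z : 𝔻, t z = F z * s z)
    {B : ℝ} (hs : ∀ z : 𝔻, ‖s z‖ ≤ B) :
    inner ℂ g t = inner ℂ h s := by
  have hB : 0 ≤ B := (norm_nonneg _).trans (hs 0)
  have hpi := Real.pi_pos
  have hev : ∀ᶠ r : ℝ in 𝓝[<] 1, 0 ≤ r ∧ r < 1 := by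
    filter_upwards [Ioo_mem_nhdsLT (zero_lt_one' ℝ)] with r hr using ⟨hr.1.le, hr.2⟩
  have hFcirc : ∀ r : ℝ, 0 ≤ r → r < 1 → Continuous fun θ : ℝ => F (r * exp (θ * I)) := by
    intro r hr0 hr1
    refine hFc.comp_continuous (by fun_prop) fun θ => ?_
    simpa only [mem_ball_zero_iff] using norm_circle_lt_one hr0 hr1 θ
  have hser : ∀ f : HardySpace, ∀ z : ℂ, ∀ hz : ‖z‖ < 1,
      series f z = f (UnitDisc.mk z hz) := fun f z hz => series_coe f (UnitDisc.mk z hz)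
  -- The only use of the unimodular radial limits: dominated convergence with bound `1`.
  have hsmall : Tendsto (fun r : ℝ => ∫ θ in (-Real.pi)..Real.pi,
      (1 - ‖F (r * exp (θ * I))‖ ^ 2) ^ 2) (𝓝[<] 1) (𝓝 0) := by
    have h0 : (0 : ℝ) = ∫ θ in (-Real.pi)..Real.pi, (0 : ℝ) := by simp
    rw [h0]
    refine intervalIntegral.tendsto_integral_filter_of_dominated_convergence (fun _ => 1)
      ?_ ?_ intervalIntegrable_const ?_
    · filter_upwards [hev] with r hr
      exact ((continuous_const.sub ((hFcirc r hr.1 hr.2).norm.pow 2)).pow 2).aestronglyMeasurable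
    · filter_upwards [hev] with r hr
      refine .of_forall fun θ _ => ?_
      have h1 := hF1 _ (mem_ball_zero_iff.2 (norm_circle_lt_one hr.1 hr.2 θ))
      have h2 : ‖F (r * exp (θ * I))‖ ^ 2 ≤ 1 := pow_le_one₀ (norm_nonneg _) h1
      have h3 : 0 ≤ ‖F (r * exp (θ * I))‖ ^ 2 := by positivity
      rw [Real.norm_of_nonneg (by positivity)]
      exact pow_le_one₀ (by linarith) (by linarith)
    · filter_upwards [hFr] with θ hθ hmem
      have := (((hθ hmem).pow 2).const_sub 1).pow 2
      simpa using this
  have hdiff := (tendsto_integral_circle h s).sub (tendsto_integral_circle g t)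
  rw [← mul_sub] at hdiff
  -- The integrands differ by `(1 - |F|²) conj h · s`. With `|s| ≤ B` and `p q ≤ ε q² + ε⁻¹ p²`, the
  -- factor `h` enters only through its square means, and the `ε⁻¹` term vanishes as `r → 1`.
  have hbound : ∀ ε : ℝ, 0 < ε →
      ‖2 * Real.pi * (inner ℂ h s - inner ℂ g t)‖ ≤ ε * (B * (2 * Real.pi * ‖h‖ ^ 2)) := by
    intro ε hε
    have hlim := (((tendsto_integral_norm_sq_circle h).const_mul B).const_mul ε).add
      (hsmall.const_mul (B * ε⁻¹))
    rw [mul_zero, add_zero] at hlim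
    refine le_of_tendsto_of_tendsto hdiff.norm hlim ?_
    filter_upwards [hev] with r hr
    have ch := continuous_series_circle h hr.1 hr.2
    have cs := continuous_series_circle s hr.1 hr.2
    have cg := continuous_series_circle g hr.1 hr.2
    have ct := continuous_series_circle t hr.1 hr.2
    have cF := hFcirc r hr.1 hr.2
    have chs : Continuous fun θ : ℝ =>
        conj (series h (r * exp (θ * I))) * series s (r * exp (θ * I)) :=
      (continuous_conj.comp ch).mul cs
    have cgt : Continuous fun θ : ℝ =>
        conj (series g (r * exp (θ * I))) * series t (r * exp (θ * I)) :=
      (continuous_conj.comp cg).mul ct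
    have c1 : Continuous fun θ : ℝ => ε * (B * ‖series h (r * exp (θ * I))‖ ^ 2) :=
      ((ch.norm.pow 2).const_mul B).const_mul ε
    have c2 : Continuous fun θ : ℝ => B * ε⁻¹ * (1 - ‖F (r * exp (θ * I))‖ ^ 2) ^ 2 :=
      ((continuous_const.sub (cF.norm.pow 2)).pow 2).const_mul (B * ε⁻¹)
    rw [← intervalIntegral.integral_sub (chs.intervalIntegrable _ _) (cgt.intervalIntegrable _ _),
      ← intervalIntegral.integral_const_mul, ← intervalIntegral.integral_const_mul,
      ← intervalIntegral.integral_const_mul, ← intervalIntegral.integral_add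
      (c1.intervalIntegrable _ _) (c2.intervalIntegrable _ _)]
    refine intervalIntegral.norm_integral_le_of_norm_le (by linarith)
      (.of_forall fun θ _ => ?_) ((c1.add c2).intervalIntegrable _ _)
    have hz := norm_circle_lt_one hr.1 hr.2 θ
    have h1 := hF1 _ (mem_ball_zero_iff.2 hz)
    rw [hser h _ hz, hser s _ hz, hser g _ hz, hser t _ hz, hg, ht]
    set z := UnitDisc.mk _ hz with hzdef
    have hzc : (z : ℂ) = r * exp (θ * I) := rfl
    rw [← hzc] at h1 ⊢
    have h2 : ‖F z‖ ^ 2 ≤ 1 := pow_le_one₀ (norm_nonneg _) h1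
    have h3 : conj (h z) * s z - conj (F z * h z) * (F z * s z) =
        ((1 - ‖F z‖ ^ 2 : ℝ) : ℂ) * (conj (h z) * s z) := by
      have : (‖F z‖ : ℂ) ^ 2 = F z * conj (F z) := by
        rw [mul_conj, normSq_eq_norm_sq]; push_cast; rfl
      push_cast
      rw [this, map_mul]
      ring
    rw [h3, norm_mul, norm_mul, RCLike.norm_conj, norm_real, Real.norm_of_nonneg (by linarith)]
    set p := 1 - ‖F z‖ ^ 2
    have hp : 0 ≤ p := by simp only [p]; linarith
    calc p * (‖h z‖ * ‖s z‖) ≤ p * (‖h z‖ * B) := by gcongr; exact hs z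
      _ = B * (p * ‖h z‖) := by ring
      _ ≤ B * (ε * ‖h z‖ ^ 2 + ε⁻¹ * p ^ 2) := by
          gcongr
          have h4 : ε * ‖h z‖ ^ 2 + ε⁻¹ * p ^ 2 - p * ‖h z‖ =
              ε⁻¹ * ((p - ε * ‖h z‖ / 2) ^ 2 + 3 / 4 * (ε * ‖h z‖) ^ 2) := by
            field_simp
            ring
          have h5 : 0 ≤ ε⁻¹ * ((p - ε * ‖h z‖ / 2) ^ 2 + 3 / 4 * (ε * ‖h z‖) ^ 2) := by
            positivity
          linarith
      _ = ε * (B * ‖h z‖ ^ 2) + B * ε⁻¹ * p ^ 2 := by ring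
  have hzero : ‖2 * Real.pi * (inner ℂ h s - inner ℂ g t)‖ ≤ 0 := by
    have hlim : Tendsto (fun ε : ℝ => ε * (B * (2 * Real.pi * ‖h‖ ^ 2))) (𝓝[>] 0) (𝓝 0) := by
      have : Continuous fun ε : ℝ => ε * (B * (2 * Real.pi * ‖h‖ ^ 2)) := by fun_prop
      simpa using (this.tendsto 0).mono_left nhdsWithin_le_nhds
    refine ge_of_tendsto hlim ?_
    filter_upwards [self_mem_nhdsWithin] with ε hε using hbound ε hε
  have := norm_le_zero_iff.1 hzero
  have h2 : (2 * Real.pi : ℂ) ≠ 0 := by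
    exact_mod_cast (by positivity : (2 * Real.pi : ℝ) ≠ 0)
  exact (sub_eq_zero.1 ((mul_eq_zero.1 this).resolve_left h2)).symm

end HardySpace

/-! ### The inner function `z φ^δ`. -/

/-- The real part of `(1 - z) / (1 + z)` is the Poisson kernel at `-1`. This gives the bound by `1`,
the unimodular radial limits and the decay towards `-1`. -/
lemma norm_exp_cayley (δ : ℝ) (z : ℂ) :
    ‖exp (-(δ : ℂ) * ((1 - z) / (1 + z)))‖ = Real.exp (-δ * ((1 - ‖z‖ ^ 2) / ‖1 + z‖ ^ 2)) := by
  rw [norm_exp]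
  congr 1
  rw [← ofReal_neg, re_ofReal_mul, div_re, ← normSq_eq_norm_sq, ← normSq_eq_norm_sq, ← add_div]
  congr 2
  simp [normSq_apply]
  ring

lemma one_add_ne_zero_of_norm_lt_one {z : ℂ} (hz : ‖z‖ < 1) : 1 + z ≠ 0 := by
  intro h
  rw [eq_neg_of_add_eq_zero_right h] at hz
  simp at hz

/-- The inner function `z φ^δ(z)` on the complex plane. -/
noncomputable def shiftedAtomic (δ : ℝ) (z : ℂ) : ℂ :=
  z * exp (-(δ : ℂ) * ((1 - z) / (1 + z)))

lemma differentiableOn_shiftedAtomic (δ : ℝ) :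
    DifferentiableOn ℂ (shiftedAtomic δ) (Metric.ball 0 1) := by
  intro z hz
  have := one_add_ne_zero_of_norm_lt_one (mem_ball_zero_iff.1 hz)
  unfold shiftedAtomic
  exact DifferentiableAt.differentiableWithinAt (by fun_prop (disch := exact this))

lemma norm_shiftedAtomic_le_one {δ : ℝ} (hδ : 0 ≤ δ) {z : ℂ} (hz : z ∈ Metric.ball (0 : ℂ) 1) :
    ‖shiftedAtomic δ z‖ ≤ 1 := by
  have hz1 := mem_ball_zero_iff.1 hz
  rw [shiftedAtomic, norm_mul, norm_exp_cayley]
  refine mul_le_one₀ hz1.le (Real.exp_pos _).le (Real.exp_le_one_iff.2 ?_)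
  have h2 : ‖z‖ ^ 2 ≤ 1 := pow_le_one₀ (norm_nonneg _) hz1.le
  have : 0 ≤ (1 - ‖z‖ ^ 2) / ‖1 + z‖ ^ 2 := div_nonneg (by linarith) (by positivity)
  nlinarith

/-- Off the atom `θ = π`, the Poisson kernel is continuous up to `r = 1` and vanishes there. -/
lemma tendsto_norm_shiftedAtomic (δ : ℝ) {θ : ℝ} (hθ : θ ∈ Set.uIoc (-Real.pi) Real.pi)
    (hne : θ ≠ Real.pi) :
    Tendsto (fun r : ℝ => ‖shiftedAtomic δ (r * exp (θ * I))‖) (𝓝[<] 1) (𝓝 1) := by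
  rw [Set.uIoc_of_le (by linarith [Real.pi_pos])] at hθ
  have h1 : 1 + exp (θ * I) ≠ 0 := by
    intro h
    apply hne
    have h2 : exp (θ * I) = exp (Real.pi * I) := by
      rw [exp_pi_mul_I]; exact eq_neg_of_add_eq_zero_right h
    have h3 := exp_inj_of_neg_pi_lt_of_le_pi (by simpa using hθ.1) (by simpa using hθ.2)
      (by simpa using Real.pi_pos) (by simp) h2
    exact_mod_cast mul_right_cancel₀ I_ne_zero h3
  simp_rw [shiftedAtomic, norm_mul, norm_exp_cayley]
  have h2 : ContinuousAt (fun r : ℝ => ‖(r : ℂ)‖ * ‖exp (θ * I)‖ * Real.exp (-δ *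
      ((1 - ‖(r : ℂ) * exp (θ * I)‖ ^ 2) / ‖1 + (r : ℂ) * exp (θ * I)‖ ^ 2))) 1 := by
    have h3 : ‖1 + ((1 : ℝ) : ℂ) * exp (θ * I)‖ ^ 2 ≠ 0 := by simpa using h1
    fun_prop (disch := exact h3)
  have h4 := h2.tendsto.mono_left (nhdsWithin_le_nhds (s := Set.Iio 1))
  simpa [norm_exp_ofReal_mul_I] using h4

/-! ### Closed range and the test functions. -/

namespace HardySpace

/-- If `b K` is closed, then multiplication by `b` is bounded below on `K`. -/
lemma exists_norm_le_of_isClosed_mulSubspace {K : Submodule ℂ HardySpace}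
    {b : 𝔻 → ℂ} (hb : ∀ z, b z ≠ 0) (hN : IsClosed (mulSubspace b K : Set HardySpace)) :
    ∃ C : ℝ, ∀ m ∈ K, ∀ f : HardySpace, (∀ z, f z = b z * m z) → ‖m‖ ≤ C * ‖f‖ := by
  have hinj : ∀ m m' : HardySpace, (∀ z, b z * m z = b z * m' z) → m = m' := fun m m' h =>
    DFunLike.ext _ _ fun z => mul_left_cancel₀ (hb z) (h z)
  have hex : ∀ f : mulSubspace b K, ∃ m ∈ K, ∀ z, (f : HardySpace) z = b z * m z := fun f => f.2
  choose S hSK hS using hex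
  have : CompleteSpace (mulSubspace b K) := hN.completeSpace_coe
  let T : mulSubspace b K →ₗ[ℂ] HardySpace :=
    { toFun := S
      map_add' := fun f g => hinj _ _ fun z => by
        rw [← hS, add_apply, mul_add, ← hS, ← hS]; rfl
      map_smul' := fun c f => hinj _ _ fun z => by
        rw [← hS, RingHom.id_apply, smul_apply, mul_left_comm, ← hS]; rfl }
  have hT : ∀ f, T f = S f := fun f => rfl
  have hc : Continuous T := by
    -- Passing to pointwise limits in `x n = b · T (x n)` gives `f = b y`, and division by `b` is
    -- unique.
    refine T.continuous_of_seq_closed_graph fun x f y hx hy => ?_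
    refine hinj _ _ fun z => ?_
    rw [hT, ← hS]
    have h1 : Tendsto (fun n => (x n : HardySpace) z) atTop (𝓝 ((f : HardySpace) z)) :=
      ((continuous_eval z).comp continuous_subtype_val).tendsto f |>.comp hx
    have h2 : Tendsto (fun n => b z * (T (x n)) z) atTop (𝓝 (b z * y z)) :=
      (((continuous_eval z).tendsto y).comp hy).const_mul _
    simp_rw [hT, ← hS] at h2
    exact tendsto_nhds_unique h2 h1
  let T' : mulSubspace b K →L[ℂ] HardySpace := ⟨T, hc⟩
  refine ⟨‖T'‖, fun m hm f hf => ?_⟩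
  have h1 : T' ⟨f, m, hm, hf⟩ = m := hinj _ _ fun z => by
    change b z * S ⟨f, m, hm, hf⟩ z = _
    rw [← hS, ← hf]
  have h2 := T'.le_opNorm ⟨f, m, hm, hf⟩
  rw [h1] at h2
  exact h2

/-- The model space contains functions of norm at least a constant times `(1 - r)^(-1/2)`, whose
products with `1 + z` are bounded by `4`. -/
lemma exists_mem_modelSpace {δ : ℝ} (hδ : 0 < δ) {r : ℝ} (hr0 : 0 ≤ r) (hr1 : r < 1) :
    ∃ f ∈ modelSpace (fun z : 𝔻 => (z : ℂ) * atomicInner δ z),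
      (1 - Real.exp (-2 * δ)) ^ 2 ≤ (1 - r ^ 2) * ‖f‖ ^ 2 ∧
      ∃ g : HardySpace, (∀ z : 𝔻, g z = (1 + (z : ℂ)) * f z) ∧ ‖g‖ ≤ 4 := by
  have hr2 : r ^ 2 < 1 := pow_lt_one₀ hr0 hr1 two_ne_zero
  let w : 𝔻 := UnitDisc.mk (-r) (by simpa [abs_of_nonneg hr0] using hr1)
  have hw : (w : ℂ) = -r := rfl
  obtain ⟨s, hs, hrep⟩ := exists_kernel w
  simp only [hw, map_neg, conj_ofReal, neg_mul, sub_neg_eq_add] at hs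
  have hden : ∀ z : ℂ, ‖z‖ < 1 → 1 - r ≤ ‖1 + (r : ℂ) * z‖ ∧ 1 + (r : ℂ) * z ≠ 0 := by
    intro z hz
    have h1 : ‖(r : ℂ) * z‖ ≤ r := by
      rw [norm_mul, norm_real, Real.norm_of_nonneg hr0]
      exact mul_le_of_le_one_right hr0 hz.le
    have h2 : 1 - r ≤ ‖1 + (r : ℂ) * z‖ := by
      have := norm_sub_le (1 + (r : ℂ) * z) ((r : ℂ) * z)
      rw [add_sub_cancel_right, norm_one] at this
      linarith
    exact ⟨h2, norm_pos_iff.1 (by linarith)⟩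
  have hsB : ∀ z : ℂ, ‖z‖ < 1 → ‖(1 + (r : ℂ) * z)⁻¹‖ ≤ (1 - r)⁻¹ := by
    intro z hz
    rw [norm_inv]
    exact inv_anti₀ (by linarith) (hden z hz).1
  have hu := differentiableOn_shiftedAtomic δ
  have hden' : ∀ z ∈ Metric.ball (0 : ℂ) 1, 1 + (r : ℂ) * z ≠ 0 := fun z hz =>
    (hden z (mem_ball_zero_iff.1 hz)).2
  have hdiff : DifferentiableOn ℂ (fun z : ℂ => (1 + (r : ℂ) * z)⁻¹) (Metric.ball 0 1) :=
    DifferentiableOn.inv (by fun_prop) hden'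
  obtain ⟨t, ht, -⟩ := exists_of_bounded (hu.mul hdiff) (C := (1 - r)⁻¹) fun z hz => by
    rw [Pi.mul_apply, norm_mul]
    exact (mul_le_of_le_one_left (norm_nonneg _) (norm_shiftedAtomic_le_one hδ.le hz)).trans
      (hsB z (mem_ball_zero_iff.1 hz))
  replace ht : ∀ z : 𝔻, t z = shiftedAtomic δ z * s z := fun z => by rw [ht, hs]; rfl
  -- With `t = u s` and this `c`, the function `s - c • t` is the reproducing kernel of the model
  -- space at `w = -r`.
  set c : ℂ := conj (shiftedAtomic δ w) with hc
  have hc1 : ‖c‖ ≤ 1 := by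
    rw [hc, RCLike.norm_conj]
    exact norm_shiftedAtomic_le_one hδ.le (mem_ball_zero_iff.2 w.norm_lt_one)
  -- The Poisson kernel at `-r` is `(1 + r) / (1 - r) ≥ 1`. Only a bound away from `1`, uniform in
  -- `r`, is needed.
  have hc2 : ‖c‖ ^ 2 ≤ Real.exp (-2 * δ) := by
    have h1 : ‖(w : ℂ)‖ = r := by rw [hw, norm_neg, norm_real, Real.norm_of_nonneg hr0]
    have h2 : ‖1 + (w : ℂ)‖ = 1 - r := by
      rw [hw, ← sub_eq_add_neg, ← ofReal_one, ← ofReal_sub, norm_real,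
        Real.norm_of_nonneg (by linarith)]
    have h3 : 1 ≤ (1 - r ^ 2) / (1 - r) ^ 2 := by
      rw [one_le_div (pow_pos (by linarith) 2)]
      nlinarith
    have h4 : ‖c‖ ≤ Real.exp (-δ) := by
      rw [hc, RCLike.norm_conj, shiftedAtomic, norm_mul, norm_exp_cayley, h1, h2]
      refine (mul_le_of_le_one_left (Real.exp_pos _).le hr1.le).trans (Real.exp_le_exp.2 ?_)
      nlinarith
    refine (pow_le_pow_left₀ (norm_nonneg _) h4 2).trans_eq ?_
    rw [← Real.exp_nat_mul]
    congr 1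
    push_cast
    ring
  have hf : ∀ z : 𝔻, (s - c • t) z = (1 - c * shiftedAtomic δ z) * (1 + (r : ℂ) * z)⁻¹ := by
    intro z
    rw [sub_eq_add_neg, ← neg_smul, add_apply, smul_apply, ht, hs]
    ring
  refine ⟨s - c • t, ?_, ?_, ?_⟩
  · rw [modelSpace, Submodule.mem_orthogonal]
    rintro g ⟨h, -, hg⟩
    have h1 := inner_mul_eq_inner hu.continuousOn
      (fun z hz => norm_shiftedAtomic_le_one hδ.le hz) (by
        filter_upwards [Measure.ae_ne volume Real.pi] with θ hne hθ
        exact tendsto_norm_shiftedAtomic δ hθ hne) hg ht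
      (fun z => by rw [hs]; exact hsB z z.norm_lt_one)
    -- Both terms equal `conj (u(w) h(w))`: the first by reproduction of `g = u h`, the second by
    -- reproduction of `h`.
    rw [inner_sub_right, inner_smul_right, h1, ← inner_conj_symm g s, ← inner_conj_symm h s,
      hrep, hrep, hg, map_mul, sub_eq_zero]
    rfl
  · have hfw := hrep (s - c • t)
    have hss := hrep s
    have hsw : s w = (((1 - r ^ 2)⁻¹ : ℝ) : ℂ) := by
      rw [hs, hw]; push_cast; ring
    rw [inner_self_eq_norm_sq_to_K, hsw] at hss
    have hss' : ‖s‖ ^ 2 = (1 - r ^ 2)⁻¹ := by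
      apply ofReal_injective
      rw [ofReal_pow]
      exact hss
    have h1 : (s - c • t) w = ((1 - ‖c‖ ^ 2 : ℝ) : ℂ) * s w := by
      rw [sub_eq_add_neg, ← neg_smul, add_apply, smul_apply, ht]
      have : (‖c‖ : ℂ) ^ 2 = c * shiftedAtomic δ w := by
        rw [hc, RCLike.norm_conj, mul_comm, mul_conj, normSq_eq_norm_sq]; push_cast; rfl
      push_cast
      rw [this]
      ring
    -- Cauchy–Schwarz against `s` avoids computing the norm of `s - c • t`; its cost is the square
    -- on `1 - e^{-2δ}`.
    have h2 : (1 - ‖c‖ ^ 2) * (1 - r ^ 2)⁻¹ ≤ ‖s‖ * ‖s - c • t‖ := by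
      have := norm_inner_le_norm (𝕜 := ℂ) s (s - c • t)
      rw [hfw, h1, hsw, ← ofReal_mul, norm_real] at this
      exact (le_abs_self _).trans this
    have hpos : 0 < 1 - r ^ 2 := by linarith
    have he : Real.exp (-2 * δ) ≤ 1 := Real.exp_le_one_iff.2 (by linarith)
    have h3 : (1 - Real.exp (-2 * δ)) * (1 - r ^ 2)⁻¹ ≤ ‖s‖ * ‖s - c • t‖ :=
      (mul_le_mul_of_nonneg_right (by linarith) (inv_pos.2 hpos).le).trans h2
    have h4 := pow_le_pow_left₀
      (mul_nonneg (by linarith) (inv_pos.2 hpos).le) h3 2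
    rw [mul_pow, mul_pow, hss'] at h4
    generalize Real.exp (-2 * δ) = e at h4 ⊢
    have h5 := mul_le_mul_of_nonneg_left h4 (sq_nonneg (1 - r ^ 2))
    field_simp at h5
    exact h5
  · obtain ⟨g, hg, hg4⟩ := exists_of_bounded (C := 4)
      (F := fun z => (1 + z) * ((1 - c * shiftedAtomic δ z) * (1 + (r : ℂ) * z)⁻¹))
      (DifferentiableOn.mul (by fun_prop)
        (DifferentiableOn.mul ((hu.const_mul c).const_sub 1) hdiff)) fun z hz => by
        have hz1 := mem_ball_zero_iff.1 hz
        have h1 : ‖1 - c * shiftedAtomic δ z‖ ≤ 2 := by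
          refine (norm_sub_le _ _).trans ?_
          rw [norm_one, norm_mul]
          have := mul_le_one₀ hc1 (norm_nonneg _) (norm_shiftedAtomic_le_one hδ.le hz)
          linarith
        -- The excess `(1 - r) z` has modulus at most `1 - r ≤ |1 + r z|`. This factor `2` and the
        -- one in `h1` make up the `4`.
        have h2 : ‖1 + z‖ ≤ 2 * ‖1 + (r : ℂ) * z‖ := by
          have h3 : 1 + z = (1 + (r : ℂ) * z) + ((1 - r : ℝ) : ℂ) * z := by push_cast; ring
          have h4 : ‖((1 - r : ℝ) : ℂ) * z‖ ≤ 1 - r := by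
            rw [norm_mul, norm_real, Real.norm_of_nonneg (by linarith)]
            exact mul_le_of_le_one_right (by linarith) hz1.le
          rw [h3]
          refine (norm_add_le _ _).trans ?_
          linarith [(hden z hz1).1]
        have hp : 0 < ‖1 + (r : ℂ) * z‖ := norm_pos_iff.2 (hden z hz1).2
        rw [norm_mul, norm_mul, norm_inv]
        calc ‖1 + z‖ * (‖1 - c * shiftedAtomic δ z‖ * ‖1 + (r : ℂ) * z‖⁻¹)
            ≤ (2 * ‖1 + (r : ℂ) * z‖) * (2 * ‖1 + (r : ℂ) * z‖⁻¹) := by gcongr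
          _ = 4 := by field_simp; norm_num
    exact ⟨g, fun z => by rw [hg, hf], hg4⟩

end HardySpace

theorem mainTheorem10 (δ : ℝ) (hδ : 0 < δ) :
    ¬ IsClosed (HardySpace.mulSubspace (fun z : 𝔻 => 1 + (z : ℂ))
      (HardySpace.modelSpace (fun z : 𝔻 => (z : ℂ) * atomicInner δ z)) : Set HardySpace) := by
  intro hcl
  obtain ⟨C, hC⟩ := HardySpace.exists_norm_le_of_isClosed_mulSubspace
    (fun z : 𝔻 => one_add_ne_zero_of_norm_lt_one z.norm_lt_one) hcl
  have he : Real.exp (-2 * δ) < 1 := by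
    simpa using hδ
  have hbound : ∀ r : ℝ, 0 ≤ r → r < 1 →
      (1 - Real.exp (-2 * δ)) ^ 2 ≤ (1 - r ^ 2) * (|C| * 4) ^ 2 := by
    intro r hr0 hr1
    obtain ⟨f, hfK, hf, g, hg, hg4⟩ := HardySpace.exists_mem_modelSpace hδ hr0 hr1
    -- The sign of `C` is not known, hence `|C|`.
    have h1 : ‖f‖ ≤ |C| * 4 := (hC f hfK g hg).trans
      (mul_le_mul (le_abs_self C) hg4 (norm_nonneg _) (abs_nonneg _))
    refine hf.trans (mul_le_mul_of_nonneg_left (pow_le_pow_left₀ (norm_nonneg _) h1 2) ?_)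
    linarith [pow_lt_one₀ hr0 hr1 two_ne_zero]
  have hlim : Tendsto (fun r : ℝ => (1 - r ^ 2) * (|C| * 4) ^ 2) (𝓝[<] 1) (𝓝 0) := by
    have : Continuous fun r : ℝ => (1 - r ^ 2) * (|C| * 4) ^ 2 := by fun_prop
    simpa using (this.tendsto 1).mono_left nhdsWithin_le_nhds
  have h0 : (1 - Real.exp (-2 * δ)) ^ 2 ≤ 0 := by
    refine ge_of_tendsto hlim ?_
    filter_upwards [Ioo_mem_nhdsLT (zero_lt_one' ℝ)] with r hr using hbound r hr.1.le hr.2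
  have : 0 < (1 - Real.exp (-2 * δ)) ^ 2 := pow_pos (by linarith) 2
  linarith
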